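/- **Setting.** Two bidders $i=1,2$ have value $1$ per click. The vector of click-through rates takes the value $r=(r_1,r_2)\in[0,1]^2$ with probability $p$ and the value $r'=(r_1',r_2')\in[0,1]^2$ with probability $1-p$, where $0<p<1$. An *information structure* is a finitely supported joint distribution $x(\rho,s)$ of click-through rates $\rho$ and signals $s\in[0,1]^2$ whose $\rho$-marginal is this prior. It is *calibrated* if $\mathbb E[\rho_i\mid s_i=t]=t$ for each bidder $i$ and each signal value $t$ of positive probability, i.e. $\sum_{(\rho,s):\,s_i=t}x(\rho,s)(\rho_i-t)=0$ for all $i,t$. Given $(\rho,s)$, the winner is the bidder $i$ with the larger signal (ties are broken uniformly at random), is clicked with probability $\rho_i$, and pays $s_j/s_i$ per click, where $j\neq i$ (a bidder winning with $s_i=0$ pays $0$); the revenue of the information structure is the resulting expected payment. *Full-disclosure* means $s=\rho$ almost surely, *no-disclosure* means $s=\mathbb E[\rho]$ almost surely; these two information structures are called *extremal*, and every other one is called *moderate*. **Theorem (Moderate Information Structures).** Suppose that each bidder's click-through rate is non-degenerate, i.e. $r_1\neq r_1'$ and $r_2\neq r_2'$, and that the two bidders' click-through rates are not identical, i.e. not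 both $r_1=r_2$ and $r_1'=r_2'$. Then there exists a moderate calibrated information structure whose revenue is strictly higher than the revenue of both no-disclosure and full-disclosure. -/

import Mathlib

open Finset

noncomputable section

/-- A vector of click-through rates, or of signals: one real number per bidder. -/
abbrev Profile (n : ℕ) := Fin n → ℝ

/-- A prior over click-through-rate vectors: a finitely supported probability distribution on
`[0, 1]ⁿ`, given by its probability mass function. -/
structure Prior (n : ℕ) where
  mass : Profile n →₀ ℝ
  nonneg : ∀ r, 0 ≤ mass r
  total : (mass.sum fun _ w => w) = 1
  mem_unit : ∀ r, mass r ≠ 0 → ∀ i, r i ∈ Set.Icc (0 : ℝ) 1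

/-- The ex-ante expected click-through rates. -/
def Prior.mean {n : ℕ} (G : Prior n) : Profile n :=
  fun i => G.mass.sum fun r w => w * r i

/-- The prior that puts probability `p` on the profile `r` and `1 - p` on the profile `r'`. -/
def Prior.twoPoint {n : ℕ} (r r' : Profile n) (p : ℝ) (hp : p ∈ Set.Icc (0 : ℝ) 1)
    (hr : ∀ i, r i ∈ Set.Icc (0 : ℝ) 1) (hr' : ∀ i, r' i ∈ Set.Icc (0 : ℝ) 1) : Prior n where
  mass := Finsupp.single r p + Finsupp.single r' (1 - p)
  nonneg := by
    classical
    intro t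
    have h1 : 0 ≤ p := hp.1
    have h2 : 0 ≤ 1 - p := sub_nonneg.mpr hp.2
    simp only [Finsupp.add_apply, Finsupp.single_apply]
    split_ifs <;> linarith
  total := by
    classical
    rw [Finsupp.sum_add_index' (fun _ => rfl) (fun _ _ _ => rfl),
      Finsupp.sum_single_index rfl, Finsupp.sum_single_index rfl]
    ring
  mem_unit := by
    classical
    intro t ht
    by_cases h : r = t
    · exact h ▸ hr
    · by_cases h' : r' = t
      · exact h' ▸ hr'
      · exact absurd (by simp [h, h']) ht

/-- An information structure for the prior `G`: a finitely supported joint distribution of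
click-through rates `r` and signals `s ∈ [0, 1]ⁿ`, given by its mass function on pairs `(r, s)`,
whose marginal on `r` is `G`. -/
structure InfoStructure {n : ℕ} (G : Prior n) where
  mass : (Profile n × Profile n) →₀ ℝ
  nonneg : ∀ z, 0 ≤ mass z
  signal_mem_unit : ∀ z, mass z ≠ 0 → ∀ i, z.2 i ∈ Set.Icc (0 : ℝ) 1
  marginal : mass.mapDomain Prod.fst = G.mass

open Classical in
/-- Calibration, `𝔼[r i | s i = t] = t` for every bidder `i` and every signal value `t`, in its
discrete form: the sum of `x(r, s) (r i - t)` over all `(r, s)` with `s i = t` vanishes. -/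
def InfoStructure.IsCalibrated {n : ℕ} {G : Prior n} (x : InfoStructure G) : Prop :=
  ∀ (i : Fin n) (t : ℝ),
    (x.mass.sum fun z w => if z.2 i = t then w * (z.1 i - t) else 0) = 0

/-- Full disclosure: `s = r` almost surely. -/
def InfoStructure.IsFullDisclosure {n : ℕ} {G : Prior n} (x : InfoStructure G) : Prop :=
  ∀ z, x.mass z ≠ 0 → z.2 = z.1

/-- No disclosure: `s = 𝔼[r]` almost surely. -/
def InfoStructure.IsNoDisclosure {n : ℕ} {G : Prior n} (x : InfoStructure G) : Prop :=
  ∀ z, x.mass z ≠ 0 → z.2 = G.mean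

/-- The extremal information structures are full disclosure and no disclosure. -/
def InfoStructure.IsExtremal {n : ℕ} {G : Prior n} (x : InfoStructure G) : Prop :=
  x.IsFullDisclosure ∨ x.IsNoDisclosure

/-- An information structure is moderate if it is not extremal. -/
def InfoStructure.IsModerate {n : ℕ} {G : Prior n} (x : InfoStructure G) : Prop :=
  ¬ x.IsExtremal

open Classical in
/-- The bidders with the largest score `v i * s i`. -/
def topBidders {n : ℕ} (v s : Profile n) : Finset (Fin n) :=
  univ.filter fun i => ∀ j, v j * s j ≤ v i * s i

/-- The price per click of bidder `i` when `i` wins: the largest `v j * s j / s i`, `j ≠ i`. -/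
def pricePerClick {n : ℕ} (v s : Profile n) (i : Fin n) : ℝ :=
  ⨆ j : {j : Fin n // j ≠ i}, v j * s j / s i

/-- Expected revenue at click-through rates `r` and signals `s`: the winner is drawn uniformly from
the bidders with the largest score (symmetric tie-breaking), is clicked with probability `r i`, and
then pays the price per click. -/
def auctionRevenue {n : ℕ} (v r s : Profile n) : ℝ :=
  (∑ i ∈ topBidders v s, r i * pricePerClick v s i) / ((topBidders v s).card : ℝ)

/-- Expected revenue of the click-through auction with values `v` under the information structure
`x`. -/
def InfoStructure.revenue {n : ℕ} {G : Prior n} (x : InfoStructure G) (v : Profile n) : ℝ :=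
  x.mass.sum fun z w => w * auctionRevenue v z.1 z.2

/-- Sending the signal vector `f r` at the click-through rates `r`. -/
def InfoStructure.ofFun {n : ℕ} (G : Prior n) (f : Profile n → Profile n)
    (hf : ∀ r, G.mass r ≠ 0 → ∀ i, f r i ∈ Set.Icc (0 : ℝ) 1) : InfoStructure G where
  mass := G.mass.mapDomain fun r => (r, f r)
  nonneg := by
    classical
    intro z
    rw [Finsupp.mapDomain, Finsupp.sum_apply]
    refine Finset.sum_nonneg fun r _ => ?_
    simp only [Finsupp.single_apply]
    split_ifs
    · exact G.nonneg r
    · exact le_rfl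
  signal_mem_unit := by
    classical
    intro z hz
    have hz' := Finsupp.mapDomain_support (Finsupp.mem_support_iff.mpr hz)
    obtain ⟨r, hr, rfl⟩ := Finset.mem_image.mp hz'
    exact hf r (Finsupp.mem_support_iff.mp hr)
  marginal := by
    rw [← Finsupp.mapDomain_comp]
    exact Finsupp.mapDomain_id

theorem InfoStructure.ofFun_signal {n : ℕ} (G : Prior n) (f : Profile n → Profile n)
    (hf : ∀ r, G.mass r ≠ 0 → ∀ i, f r i ∈ Set.Icc (0 : ℝ) 1) (z : Profile n × Profile n)
    (hz : (InfoStructure.ofFun G f hf).mass z ≠ 0) : z.2 = f z.1 := by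
  classical
  have hz' := Finsupp.mapDomain_support (Finsupp.mem_support_iff.mpr hz)
  obtain ⟨r, _, rfl⟩ := Finset.mem_image.mp hz'
  rfl

/-- Full disclosure exists for every prior. -/
theorem exists_isFullDisclosure {n : ℕ} (G : Prior n) :
    ∃ x : InfoStructure G, x.IsFullDisclosure :=
  ⟨InfoStructure.ofFun G id G.mem_unit, InfoStructure.ofFun_signal G id G.mem_unit⟩

theorem Prior.mean_mem_unit {n : ℕ} (G : Prior n) (i : Fin n) :
    G.mean i ∈ Set.Icc (0 : ℝ) 1 := by
  constructor
  · exact Finset.sum_nonneg fun r hr =>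
      mul_nonneg (G.nonneg r) (G.mem_unit r (Finsupp.mem_support_iff.mp hr) i).1
  · rw [← G.total]
    exact Finset.sum_le_sum fun r hr =>
      mul_le_of_le_one_right (G.nonneg r) (G.mem_unit r (Finsupp.mem_support_iff.mp hr) i).2

/-- No disclosure exists for every prior. -/
theorem exists_isNoDisclosure {n : ℕ} (G : Prior n) :
    ∃ x : InfoStructure G, x.IsNoDisclosure :=
  ⟨InfoStructure.ofFun G (fun _ => G.mean) fun _ _ => G.mean_mem_unit,
    InfoStructure.ofFun_signal G (fun _ => G.mean) fun _ _ => G.mean_mem_unit⟩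

end

/-!
A single bidder `k` never yields more than `v k * 𝔼[r k]` under an extremal information structure,
so it suffices to beat one of these two numbers near no disclosure. Let the bidders receive
independent signals while the posterior probability of `r` also depends on the *product* of the two
signals, a dependence that calibration does not see. If one bidder has the higher expected score,
that bidder always wins, and revenue changes by the covariance of the winner's click-through rate
with the loser's signal; weighted by the reciprocal of the winner's signal this covariance can be
made positive. If the expected scores are equal, the price per click tends to the winner's value,
so revenue tends to the expected score of the winner at the true click-through rates, and the
product dependence makes the bidder with the more favourable rates win more often.
-/

open Filter Topology
open AffineMap (lineMap)

section Auction

theorem pricePerClick_of_ne (v s : Profile 2) {i j : Fin 2} (hij : j ≠ i) :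
    pricePerClick v s i = v j * s j / s i := by
  have eq_j : ∀ k : {k : Fin 2 // k ≠ i}, (k : Fin 2) = j := fun k => by
    have := k.2
    omega
  have : Nonempty {k : Fin 2 // k ≠ i} := ⟨⟨j, hij⟩⟩
  simp only [pricePerClick, eq_j, ciSup_const]

theorem topBidders_of_lt {v s : Profile 2} {i j : Fin 2} (h : v j * s j < v i * s i) :
    topBidders v s = {i} := by
  have hij : j ≠ i := ne_of_apply_ne (fun k => v k * s k) h.ne
  ext k
  simp only [topBidders, mem_filter, mem_univ, true_and, mem_singleton]
  constructor
  · intro hk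
    by_contra hki
    obtain rfl : k = j := by omega
    exact (hk i).not_gt h
  · rintro rfl l
    rcases eq_or_ne l k with rfl | hl
    · exact le_rfl
    · obtain rfl : l = j := by omega
      exact h.le

theorem auctionRevenue_of_lt {v s : Profile 2} (r : Profile 2) {i j : Fin 2}
    (h : v j * s j < v i * s i) : auctionRevenue v r s = r i * (v j * s j / s i) := by
  have hij : j ≠ i := ne_of_apply_ne (fun k => v k * s k) h.ne
  simp only [auctionRevenue, topBidders_of_lt h, sum_singleton, card_singleton, Nat.cast_one,
    div_one, pricePerClick_of_ne v s hij]

theorem auctionRevenue_self_le {v r : Profile 2} (hv : ∀ i, 0 ≤ v i) (hr : ∀ i, 0 ≤ r i)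
    (k : Fin 2) : auctionRevenue v r r ≤ v k * r k := by
  have payment_le : ∀ i ∈ topBidders v r, r i * pricePerClick v r i ≤ v k * r k := by
    intro i hi
    obtain ⟨j, hij⟩ := exists_ne i
    calc r i * pricePerClick v r i
        = r i * (v j * r j / r i) := by rw [pricePerClick_of_ne v r hij]
      _ = v j * r j * (r i / r i) := mul_div_left_comm _ _ _
      _ ≤ v j * r j :=
        mul_le_of_le_one_right (mul_nonneg (hv j) (hr j)) (div_self_le_one _)
      _ ≤ v k * r k := by
        rcases eq_or_ne k j with rfl | hkj
        · exact le_rfl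
        · obtain rfl : k = i := by omega
          exact (mem_filter.mp hi).2 j
  refine div_le_of_le_mul₀ (Nat.cast_nonneg _) (mul_nonneg (hv k) (hr k)) ?_
  rw [mul_comm, ← nsmul_eq_mul]
  exact sum_le_card_nsmul _ _ _ payment_le

theorem isLinearMap_auctionRevenue {n : ℕ} (v s : Profile n) :
    IsLinearMap ℝ fun r => auctionRevenue v r s where
  map_add r r' := by simp only [auctionRevenue, Pi.add_apply, add_mul, sum_add_distrib, add_div]
  map_smul c r := by
    simp only [auctionRevenue, Pi.smul_apply, smul_eq_mul, mul_assoc, ← mul_sum, mul_div_assoc]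

-- Near a tie the winner's price per click is close to the winner's value.
theorem tendsto_auctionRevenue_of_tie {X : Type*} {l : Filter X} {v r₀ s₀ : Profile 2}
    {r s : X → Profile 2} {i j : Fin 2} (hlt : ∀ᶠ x in l, v j * s x j < v i * s x i)
    (hr : Tendsto r l (𝓝 r₀)) (hs : Tendsto s l (𝓝 s₀)) (hi : s₀ i ≠ 0)
    (htie : v j * s₀ j = v i * s₀ i) :
    Tendsto (fun x => auctionRevenue v (r x) (s x)) l (𝓝 (v i * r₀ i)) := by
  have hs' := tendsto_pi_nhds.mp hs
  have limit := (tendsto_pi_nhds.mp hr i).mul (((hs' j).const_mul (v j)).div (hs' i) hi)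
  rw [htie, mul_div_cancel_right₀ _ hi, mul_comm] at limit
  exact limit.congr' (hlt.mono fun x hx => (auctionRevenue_of_lt (r x) hx).symm)

end Auction

section Extremal

theorem Prior.sum_auctionRevenue {n : ℕ} (G : Prior n) (v s : Profile n) :
    (G.mass.sum fun r w => w * auctionRevenue v r s) = auctionRevenue v G.mean s := by
  have mean_eq : G.mean = G.mass.sum fun r w => w • r := by
    ext i
    simp [Prior.mean, Finsupp.sum]
  have linear := map_finsuppSum ((isLinearMap_auctionRevenue v s).mk' _) G.mass fun r w => w • r
  simpa only [mean_eq, map_smul, IsLinearMap.mk'_apply, smul_eq_mul] using linear.symm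

theorem InfoStructure.sum_fst {n : ℕ} {G : Prior n} (x : InfoStructure G) (f : Profile n → ℝ) :
    (x.mass.sum fun z w => w * f z.1) = G.mass.sum fun r w => w * f r := by
  rw [← x.marginal, Finsupp.sum_mapDomain_index (fun _ => zero_mul _) fun _ _ _ => add_mul _ _ _]

variable {G : Prior 2} {x : InfoStructure G} {v : Profile 2}

theorem InfoStructure.IsFullDisclosure.revenue_le (hx : x.IsFullDisclosure)
    (hv : ∀ i, 0 ≤ v i) (k : Fin 2) : x.revenue v ≤ v k * G.mean k := by
  calc x.revenue v
      ≤ x.mass.sum fun z w => w * (v k * z.1 k) := by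
        refine Finset.sum_le_sum fun z hz => mul_le_mul_of_nonneg_left ?_ (x.nonneg z)
        have hz := Finsupp.mem_support_iff.mp hz
        have hrate : ∀ i, 0 ≤ z.1 i := fun i => hx z hz ▸ (x.signal_mem_unit z hz i).1
        simpa only [hx z hz] using auctionRevenue_self_le hv hrate k
    _ = G.mass.sum fun r w => w * (v k * r k) := x.sum_fst fun r => v k * r k
    _ = v k * G.mean k := by simp only [Prior.mean, Finsupp.mul_sum, mul_left_comm]

theorem InfoStructure.IsNoDisclosure.revenue_le (hx : x.IsNoDisclosure)
    (hv : ∀ i, 0 ≤ v i) (k : Fin 2) : x.revenue v ≤ v k * G.mean k := by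
  calc x.revenue v
      = x.mass.sum fun z w => w * auctionRevenue v z.1 G.mean :=
        Finsupp.sum_congr fun z hz => by rw [hx z (Finsupp.mem_support_iff.mp hz)]
    _ = auctionRevenue v G.mean G.mean := by
        rw [x.sum_fst fun r => auctionRevenue v r G.mean, G.sum_auctionRevenue]
    _ ≤ v k * G.mean k := auctionRevenue_self_le hv (fun i => (G.mean_mem_unit i).1) k

theorem InfoStructure.IsExtremal.revenue_le (hx : x.IsExtremal)
    (hv : ∀ i, 0 ≤ v i) (k : Fin 2) : x.revenue v ≤ v k * G.mean k :=
  hx.elim (fun h => h.revenue_le hv k) fun h => h.revenue_le hv k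

theorem Prior.mean_twoPoint {n : ℕ} (r r' : Profile n) (p : ℝ) (hp : p ∈ Set.Icc (0 : ℝ) 1)
    (hr : ∀ i, r i ∈ Set.Icc (0 : ℝ) 1) (hr' : ∀ i, r' i ∈ Set.Icc (0 : ℝ) 1) :
    (Prior.twoPoint r r' p hp hr hr').mean = lineMap r' r p := by
  ext k
  rw [AffineMap.pi_lineMap_apply, AffineMap.lineMap_apply_ring]
  simp only [Prior.mean, Prior.twoPoint]
  rw [Finsupp.sum_add_index' (fun _ => zero_mul _) (fun _ _ _ => add_mul _ _ _),
    Finsupp.sum_single_index (zero_mul _), Finsupp.sum_single_index (zero_mul _), add_comm]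

end Extremal

section Posterior

variable {n : ℕ} {r r' : Profile n} {p : ℝ} {hp : p ∈ Set.Icc (0 : ℝ) 1}
  {hr : ∀ i, r i ∈ Set.Icc (0 : ℝ) 1} {hr' : ∀ i, r' i ∈ Set.Icc (0 : ℝ) 1}
  {ι : Type*} [Fintype ι] {w q : ι → ℝ} {s : ι → Profile n}

/-- The joint law of click-through rates and signals when an outcome `a` of weight `w a` is drawn,
the signals are `s a`, and the rates are then `r` with probability `q a` and `r'` otherwise. -/
noncomputable def posteriorMass (r r' : Profile n) (w q : ι → ℝ) (s : ι → Profile n) :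
    (Profile n × Profile n) →₀ ℝ :=
  ∑ a, (Finsupp.single (r, s a) (w a * q a) + Finsupp.single (r', s a) (w a * (1 - q a)))

theorem sum_posteriorMass (f : Profile n × Profile n → ℝ) :
    ((posteriorMass r r' w q s).sum fun z c => c * f z)
      = ∑ a, w a * lineMap (f (r', s a)) (f (r, s a)) (q a) := by
  have zero : ∀ z, (0 : ℝ) * f z = 0 := fun _ => zero_mul _
  have add : ∀ z (c c' : ℝ), (c + c') * f z = c * f z + c' * f z := fun _ _ _ => add_mul _ _ _
  rw [posteriorMass, ← Finsupp.sum_finsetSum_index zero add]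
  refine sum_congr rfl fun a _ => ?_
  rw [Finsupp.sum_add_index' zero add, Finsupp.sum_single_index (zero _),
    Finsupp.sum_single_index (zero _), AffineMap.lineMap_apply_ring]
  ring

theorem posteriorMass_nonneg (hw : ∀ a, 0 ≤ w a) (hq : ∀ a, q a ∈ Set.Icc (0 : ℝ) 1) :
    0 ≤ posteriorMass r r' w q s :=
  sum_nonneg fun a _ => add_nonneg
    (Finsupp.single_nonneg.mpr (mul_nonneg (hw a) (hq a).1))
    (Finsupp.single_nonneg.mpr (mul_nonneg (hw a) (sub_nonneg.mpr (hq a).2)))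

theorem exists_signal_eq_of_posteriorMass_ne_zero {z : Profile n × Profile n}
    (hz : posteriorMass r r' w q s z ≠ 0) : ∃ a, s a = z.2 := by
  classical
  rw [posteriorMass, Finsupp.finsetSum_apply] at hz
  obtain ⟨a, -, ha⟩ := exists_ne_zero_of_sum_ne_zero hz
  refine ⟨a, ?_⟩
  contrapose! ha
  have hne : ∀ t : Profile n, (t, s a) ≠ z := fun t h => ha (congrArg Prod.snd h)
  simp [hne]

theorem mapDomain_fst_posteriorMass (hw : ∑ a, w a = 1) (hwq : ∑ a, w a * q a = p) :
    (posteriorMass r r' w q s).mapDomain Prod.fst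
      = Finsupp.single r p + Finsupp.single r' (1 - p) := by
  have hwq' : ∑ a, w a * (1 - q a) = 1 - p := by
    simp only [mul_sub, mul_one, sum_sub_distrib, hw, hwq]
  simp only [posteriorMass, Finsupp.mapDomain_finsetSum, Finsupp.mapDomain_add,
    Finsupp.mapDomain_single, sum_add_distrib, ← Finsupp.single_finsetSum, hwq, hwq']

/-- The information structure that draws an outcome `a` of weight `w a`, sends the signals `s a`,
and induces the posterior probability `q a` of the rates `r`. -/
noncomputable def InfoStructure.ofPosterior (hw : w ∈ stdSimplex ℝ ι)
    (hq : ∀ a, q a ∈ Set.Icc (0 : ℝ) 1) (hwq : ∑ a, w a * q a = p)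
    (hs : ∀ a k, s a k ∈ Set.Icc (0 : ℝ) 1) : InfoStructure (Prior.twoPoint r r' p hp hr hr') where
  mass := posteriorMass r r' w q s
  nonneg := posteriorMass_nonneg hw.1 hq
  signal_mem_unit z hz := by
    obtain ⟨a, ha⟩ := exists_signal_eq_of_posteriorMass_ne_zero hz
    exact ha ▸ hs a
  marginal := mapDomain_fst_posteriorMass hw.2 hwq

variable {hw : w ∈ stdSimplex ℝ ι} {hq : ∀ a, q a ∈ Set.Icc (0 : ℝ) 1}
  {hwq : ∑ a, w a * q a = p} {hs : ∀ a k, s a k ∈ Set.Icc (0 : ℝ) 1}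

theorem InfoStructure.revenue_ofPosterior (v : Profile n) :
    (ofPosterior (hp := hp) (hr := hr) (hr' := hr') hw hq hwq hs).revenue v
      = ∑ a, w a * auctionRevenue v (lineMap r' r (q a)) (s a) := by
  refine (sum_posteriorMass fun z => auctionRevenue v z.1 z.2).trans ?_
  refine sum_congr rfl fun a _ => congrArg (w a * ·) ?_
  exact (((isLinearMap_auctionRevenue v (s a)).mk' _).toAffineMap.apply_lineMap r' r (q a)).symm

theorem InfoStructure.isCalibrated_ofPosterior
    (h : ∀ k t, ∑ a with s a k = t, w a * (lineMap (r' k) (r k) (q a) - t) = 0) :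
    (ofPosterior (hp := hp) (hr := hr) (hr' := hr') hw hq hwq hs).IsCalibrated := by
  classical
  intro k t
  calc (ofPosterior hw hq hwq hs).mass.sum
        (fun z c => if z.2 k = t then c * (z.1 k - t) else 0)
      = (posteriorMass r r' w q s).sum
        fun z c => c * if z.2 k = t then z.1 k - t else 0 := by
        simp only [mul_ite, mul_zero]
        rfl
    _ = ∑ a, if s a k = t then w a * (lineMap (r' k) (r k) (q a) - t) else 0 := by
        rw [sum_posteriorMass]
        refine sum_congr rfl fun a _ => ?_
        split_ifs <;> simp only [AffineMap.lineMap_apply_ring] <;> ring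
    _ = 0 := by rw [← sum_filter, h k t]

end Posterior

section Observations

variable {A B : Type*}

theorem sum_mul_lineMap [Fintype B] {ν : B → ℝ} (hν : ∑ b, ν b = 1) (q : B → ℝ) (x y : ℝ) :
    ∑ b, ν b * lineMap x y (q b) = lineMap x y (∑ b, ν b * q b) := by
  simp only [AffineMap.lineMap_apply_ring', mul_add, sum_add_distrib, ← sum_mul, ← mul_assoc, hν,
    one_mul]

theorem sum_mul_lineMap_mul_lineMap [Fintype B] {ν : B → ℝ} (hν : ∑ b, ν b = 1) (q g : B → ℝ)
    (x y x' y' : ℝ) :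
    ∑ b, ν b * (lineMap x y (q b) * lineMap x' y' (g b))
      = lineMap x y (∑ b, ν b * q b) * lineMap x' y' (∑ b, ν b * g b)
        + (y - x) * (y' - x') * ∑ b, ν b * (q b * (g b - ∑ c, ν c * g c)) := by
  set mean := ∑ b, ν b * g b
  have centered : ∑ b, ν b * (g b - mean) = 0 := by
    simp only [mul_sub, sum_sub_distrib, ← sum_mul, hν, one_mul, mean, sub_self]
  calc ∑ b, ν b * (lineMap x y (q b) * lineMap x' y' (g b))
      = ∑ b, (ν b * lineMap x y (q b) * lineMap x' y' mean
          + (y - x) * (y' - x') * (ν b * (q b * (g b - mean)))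
          + x * (y' - x') * (ν b * (g b - mean))) := by
        refine sum_congr rfl fun b _ => ?_
        simp only [AffineMap.lineMap_apply_ring']
        ring
    _ = _ := by
        rw [sum_add_distrib, sum_add_distrib, ← sum_mul, ← mul_sum, ← mul_sum, centered, mul_zero,
          add_zero, sum_mul_lineMap hν]

theorem prod_mem_stdSimplex [Fintype A] [Fintype B] {μ : A → ℝ} {ν : B → ℝ}
    (hμ : μ ∈ stdSimplex ℝ A) (hν : ν ∈ stdSimplex ℝ B) :
    (fun z : A × B => μ z.1 * ν z.2) ∈ stdSimplex ℝ (A × B) := by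
  refine ⟨fun z => mul_nonneg (hμ.1 z.1) (hν.1 z.2), ?_⟩
  rw [Fintype.sum_prod_type, ← Fintype.sum_mul_sum, hμ.2, hν.2, one_mul]

/-- The expectation of `q a b` over `b` with law `ν`: when `b` is independent of `a` and `q` is a
posterior probability given both, this is the posterior probability given `a` alone. -/
def condPosterior [Fintype B] (ν : B → ℝ) (q : A → B → ℝ) (a : A) : ℝ :=
  ∑ b, ν b * q a b

theorem condPosterior_mem_unit [Fintype B] {ν : B → ℝ} {q : A → B → ℝ} (hν : ν ∈ stdSimplex ℝ B)
    (hq : ∀ a b, q a b ∈ Set.Icc (0 : ℝ) 1) (a : A) : condPosterior ν q a ∈ Set.Icc (0 : ℝ) 1 :=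
  (convex_Icc 0 1).sum_mem (fun b _ => hν.1 b) hν.2 fun b _ => hq a b

theorem sum_mul_lineMap_sub_condPosterior [Fintype B] {ν : B → ℝ} (hν : ∑ b, ν b = 1)
    (q : A → B → ℝ) (x y : ℝ) (a : A) :
    ∑ b, ν b * (lineMap x y (q a b) - lineMap x y (condPosterior ν q a)) = 0 := by
  simp only [mul_sub, sum_sub_distrib, ← sum_mul, hν, one_mul, condPosterior, sum_mul_lineMap hν,
    sub_self]

variable [Fintype A] [Fintype B] {μ : A → ℝ} {ν : B → ℝ} {q : A → B → ℝ}

theorem sum_mul_condPosterior_flip (μ : A → ℝ) (ν : B → ℝ) (q : A → B → ℝ) :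
    ∑ b, ν b * condPosterior μ (flip q) b = ∑ a, μ a * condPosterior ν q a := by
  simp only [condPosterior, flip, mul_sum]
  rw [sum_comm]
  simp only [mul_left_comm]

variable {n : ℕ} {r r' : Profile n} {p : ℝ} {hp : p ∈ Set.Icc (0 : ℝ) 1}
  {hr : ∀ i, r i ∈ Set.Icc (0 : ℝ) 1} {hr' : ∀ i, r' i ∈ Set.Icc (0 : ℝ) 1}

/-- The calibrated signals when bidder `i` observes `a` and every other bidder observes `b`, where
`a` and `b` are independent with laws `μ` and `ν` and `q a b` is the posterior probability of the
rates `r`. -/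
def observationSignal (r r' : Profile n) (i : Fin n) (μ : A → ℝ) (ν : B → ℝ) (q : A → B → ℝ)
    (a : A) (b : B) : Profile n := fun k =>
  lineMap (r' k) (r k) (if k = i then condPosterior ν q a else condPosterior μ (flip q) b)

theorem observationSignal_self (i : Fin n) (a : A) (b : B) :
    observationSignal r r' i μ ν q a b i = lineMap (r' i) (r i) (condPosterior ν q a) := by
  rw [observationSignal, if_pos rfl]

theorem observationSignal_of_ne {i k : Fin n} (hk : k ≠ i) (a : A) (b : B) :
    observationSignal r r' i μ ν q a b k = lineMap (r' k) (r k) (condPosterior μ (flip q) b) := by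
  rw [observationSignal, if_neg hk]

theorem observationSignal_mem_unit (hμ : μ ∈ stdSimplex ℝ A) (hν : ν ∈ stdSimplex ℝ B)
    (hq : ∀ a b, q a b ∈ Set.Icc (0 : ℝ) 1) (hr : ∀ i, r i ∈ Set.Icc (0 : ℝ) 1)
    (hr' : ∀ i, r' i ∈ Set.Icc (0 : ℝ) 1) (i : Fin n) (a : A) (b : B) (k : Fin n) :
    observationSignal r r' i μ ν q a b k ∈ Set.Icc (0 : ℝ) 1 := by
  refine (convex_Icc 0 1).lineMap_mem (hr' k) (hr k) ?_
  split_ifs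
  · exact condPosterior_mem_unit hν hq a
  · exact condPosterior_mem_unit hμ (fun b a => hq a b) b

/-- Bidder `i` observes `a` and every other bidder observes `b`, where `a` and `b` are independent
with laws `μ` and `ν`; the posterior probability of the rates `r` given both is `q a b`. -/
noncomputable def InfoStructure.ofObservations (i : Fin n) (hμ : μ ∈ stdSimplex ℝ A)
    (hν : ν ∈ stdSimplex ℝ B) (hq : ∀ a b, q a b ∈ Set.Icc (0 : ℝ) 1)
    (hqp : ∑ a, μ a * condPosterior ν q a = p) : InfoStructure (Prior.twoPoint r r' p hp hr hr') :=
  ofPosterior (w := fun z : A × B => μ z.1 * ν z.2) (q := fun z => q z.1 z.2)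
    (s := fun z => observationSignal r r' i μ ν q z.1 z.2)
    (prod_mem_stdSimplex hμ hν) (fun z => hq z.1 z.2)
    (by simpa only [Fintype.sum_prod_type, condPosterior, mul_sum, mul_assoc] using hqp)
    fun z => observationSignal_mem_unit hμ hν hq hr hr' i z.1 z.2

variable {hμ : μ ∈ stdSimplex ℝ A} {hν : ν ∈ stdSimplex ℝ B}
  {hq : ∀ a b, q a b ∈ Set.Icc (0 : ℝ) 1} {hqp : ∑ a, μ a * condPosterior ν q a = p}

theorem InfoStructure.revenue_ofObservations (i : Fin n) (v : Profile n) :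
    (ofObservations (hp := hp) (hr := hr) (hr' := hr') i hμ hν hq hqp).revenue v
      = ∑ a, ∑ b, μ a * ν b *
          auctionRevenue v (lineMap r' r (q a b)) (observationSignal r r' i μ ν q a b) := by
  rw [ofObservations, revenue_ofPosterior, Fintype.sum_prod_type]

theorem InfoStructure.isCalibrated_ofObservations (i : Fin n) :
    (ofObservations (hp := hp) (hr := hr) (hr' := hr') i hμ hν hq hqp).IsCalibrated := by
  refine isCalibrated_ofPosterior fun k t => ?_
  rw [sum_filter, Fintype.sum_prod_type]
  rcases eq_or_ne k i with rfl | hk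
  · refine sum_eq_zero fun a _ => ?_
    simp only [observationSignal_self]
    split_ifs with ht
    · simp only [← ht, mul_assoc, ← mul_sum, sum_mul_lineMap_sub_condPosterior hν.2, mul_zero]
    · exact sum_const_zero
  · rw [sum_comm]
    refine sum_eq_zero fun b _ => ?_
    simp only [observationSignal_of_ne hk]
    split_ifs with ht
    · have residual := sum_mul_lineMap_sub_condPosterior hμ.2 (flip q) (r' k) (r k) b
      simp only [flip] at residual
      simp only [← ht, mul_comm _ (ν b), mul_assoc, ← mul_sum, residual, mul_zero]
    · exact sum_const_zero

theorem InfoStructure.revenue_ofObservations_of_forall_lt {r r' : Profile 2}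
    {hr : ∀ i, r i ∈ Set.Icc (0 : ℝ) 1} {hr' : ∀ i, r' i ∈ Set.Icc (0 : ℝ) 1} {v : Profile 2}
    {i j : Fin 2} (hij : j ≠ i)
    (hwin : ∀ a b, v j * lineMap (r' j) (r j) (condPosterior μ (flip q) b)
      < v i * lineMap (r' i) (r i) (condPosterior ν q a))
    (hne : ∀ a, lineMap (r' i) (r i) (condPosterior ν q a) ≠ 0) :
    (ofObservations (hp := hp) (hr := hr) (hr' := hr') i hμ hν hq hqp).revenue v
      = v j * (lineMap (r' j) (r j) p + (r i - r' i) * (r j - r' j) *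
          ∑ a, μ a * ((∑ b, ν b * (q a b * (condPosterior μ (flip q) b - p)))
            / lineMap (r' i) (r i) (condPosterior ν q a))) := by
  set g := condPosterior μ (flip q)
  set D := (r i - r' i) * (r j - r' j)
  have mean_g : ∑ b, ν b * g b = p := (sum_mul_condPosterior_flip μ ν q).trans hqp
  have payment : ∀ a b, auctionRevenue v (lineMap r' r (q a b)) (observationSignal r r' i μ ν q a b)
      = lineMap (r' i) (r i) (q a b)
        * (v j * lineMap (r' j) (r j) (g b) / lineMap (r' i) (r i) (condPosterior ν q a)) := by
    intro a b
    rw [auctionRevenue_of_lt (i := i) (j := j), observationSignal_self,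
      observationSignal_of_ne hij, AffineMap.pi_lineMap_apply]
    rw [observationSignal_self, observationSignal_of_ne hij]
    exact hwin a b
  have revenue_of_obs : ∀ a, ∑ b, ν b * (lineMap (r' i) (r i) (q a b)
        * (v j * lineMap (r' j) (r j) (g b) / lineMap (r' i) (r i) (condPosterior ν q a)))
      = v j * lineMap (r' j) (r j) p + v j * (D * ((∑ b, ν b * (q a b * (g b - p)))
          / lineMap (r' i) (r i) (condPosterior ν q a))) := by
    intro a
    have cov := sum_mul_lineMap_mul_lineMap hν.2 (q a) g (r' i) (r i) (r' j) (r j)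
    rw [mean_g] at cov
    calc _ = v j / lineMap (r' i) (r i) (condPosterior ν q a) * ∑ b, ν b
          * (lineMap (r' i) (r i) (q a b) * lineMap (r' j) (r j) (g b)) := by
          rw [mul_sum]
          exact sum_congr rfl fun b _ => by ring
      _ = _ := by
          rw [cov, ← condPosterior]
          field_simp [hne a]
          ring
  simp only [revenue_ofObservations, payment, mul_assoc (μ _), ← mul_sum, revenue_of_obs]
  simp only [mul_add, sum_add_distrib, ← sum_mul, hμ.2, one_mul, mul_left_comm (μ _), ← mul_sum]

end Observations

section Interaction

/-- Bidder `i`'s observation: a centred score that is high on the rarer outcome. Skewing the two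
observations in opposite directions makes the winner of near-tied scores correlate with the product
of the observations; for symmetric `±1` observations that correlation would vanish. -/
def rareHigh : Fin 2 → ℝ := ![2, -1]

/-- The law under which `rareHigh` has mean zero. -/
noncomputable def rareHighLaw : Fin 2 → ℝ := ![1 / 3, 2 / 3]

/-- The other bidder's observation: a centred score that is low on the rarer outcome. -/
def rareLow : Fin 2 → ℝ := ![1, -2]

/-- The law under which `rareLow` has mean zero. -/
noncomputable def rareLowLaw : Fin 2 → ℝ := ![2 / 3, 1 / 3]

theorem rareHighLaw_mem_stdSimplex : rareHighLaw ∈ stdSimplex ℝ (Fin 2) := by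
  constructor <;> norm_num [rareHighLaw, Fin.forall_fin_two]

theorem rareLowLaw_mem_stdSimplex : rareLowLaw ∈ stdSimplex ℝ (Fin 2) := by
  constructor <;> norm_num [rareLowLaw, Fin.forall_fin_two]

theorem rareLow_ne_rareHigh (a b : Fin 2) : rareLow b ≠ rareHigh a := by
  fin_cases a <;> fin_cases b <;> norm_num [rareLow, rareHigh]

/-- The posterior probability of the first rate profile given both observations: the prior `p`, plus
main effects `α` and `β` of the two observations, plus an interaction `γ` that neither bidder sees
in its own observation. -/
def interactionPosterior (p α β γ : ℝ) (a b : Fin 2) : ℝ :=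
  p + α * rareHigh a + β * rareLow b + γ * (rareHigh a * rareLow b)

theorem condPosterior_interactionPosterior (p α β γ : ℝ) (a : Fin 2) :
    condPosterior rareLowLaw (interactionPosterior p α β γ) a = p + α * rareHigh a := by
  simp only [condPosterior, interactionPosterior, rareLowLaw, rareLow, Fin.sum_univ_two,
    Matrix.cons_val_zero, Matrix.cons_val_one]
  ring

theorem condPosterior_flip_interactionPosterior (p α β γ : ℝ) (b : Fin 2) :
    condPosterior rareHighLaw (flip (interactionPosterior p α β γ)) b = p + β * rareLow b := by
  simp only [condPosterior, flip, interactionPosterior, rareHighLaw, rareHigh, Fin.sum_univ_two,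
    Matrix.cons_val_zero, Matrix.cons_val_one]
  ring

theorem sum_mul_condPosterior_interactionPosterior (p α β γ : ℝ) :
    ∑ a, rareHighLaw a * condPosterior rareLowLaw (interactionPosterior p α β γ) a = p := by
  simp only [condPosterior_interactionPosterior, rareHighLaw, rareHigh, Fin.sum_univ_two,
    Matrix.cons_val_zero, Matrix.cons_val_one]
  ring

theorem sum_mul_interactionPosterior_mul_rareLow (p α β γ : ℝ) (a : Fin 2) :
    ∑ b, rareLowLaw b * (interactionPosterior p α β γ a b * (β * rareLow b))
      = 2 * β * (β + γ * rareHigh a) := by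
  simp only [interactionPosterior, rareLowLaw, rareLow, Fin.sum_univ_two,
    Matrix.cons_val_zero, Matrix.cons_val_one]
  ring

theorem sum_rareHighLaw_mul_div {m d : ℝ} (hne : ∀ a, m + d * rareHigh a ≠ 0) (β γ : ℝ) :
    ∑ a, rareHighLaw a * (2 * β * (β + γ * rareHigh a) / (m + d * rareHigh a))
      = 2 * β * (β * (m + d) - 2 * γ * d) / ∏ a, (m + d * rareHigh a) := by
  have factor₀ : m + d * rareHigh 0 = m + 2 * d := by
    simp only [rareHigh, Matrix.cons_val_zero, mul_comm]
  have factor₁ : m + d * rareHigh 1 = m - d := by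
    simp only [rareHigh, Matrix.cons_val_one, Matrix.cons_val_zero, mul_neg_one, sub_eq_add_neg]
  have hne₀ := factor₀ ▸ hne 0
  have hne₁ := factor₁ ▸ hne 1
  rw [Fin.sum_univ_two, Fin.prod_univ_two, factor₀, factor₁]
  simp only [rareHighLaw, rareHigh, Matrix.cons_val_zero, Matrix.cons_val_one]
  field_simp
  ring

theorem tendsto_interactionPosterior {X : Type*} {l : Filter X} {p γ₀ : ℝ} {α β γ : X → ℝ}
    (hα : Tendsto α l (𝓝 0)) (hβ : Tendsto β l (𝓝 0)) (hγ : Tendsto γ l (𝓝 γ₀)) (a b : Fin 2) :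
    Tendsto (fun x => interactionPosterior p (α x) (β x) (γ x) a b) l
      (𝓝 (p + γ₀ * (rareHigh a * rareLow b))) := by
  have limit := (((hα.mul_const (rareHigh a)).const_add p).add (hβ.mul_const (rareLow b))).add
    (hγ.mul_const (rareHigh a * rareLow b))
  rwa [zero_mul, add_zero, zero_mul, add_zero] at limit

theorem tendsto_observationSignal_interactionPosterior {X : Type*} {l : Filter X}
    {r r' : Profile 2} {p : ℝ} {α β : X → ℝ} (i : Fin 2) (hα : Tendsto α l (𝓝 0))
    (hβ : Tendsto β l (𝓝 0)) (γ : X → ℝ) (a b : Fin 2) :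
    Tendsto (fun x => observationSignal r r' i rareHighLaw rareLowLaw
      (interactionPosterior p (α x) (β x) (γ x)) a b) l (𝓝 (lineMap r' r p)) := by
  have main_effect : ∀ {δ : X → ℝ} (t : ℝ), Tendsto δ l (𝓝 0) →
      Tendsto (fun x => p + δ x * t) l (𝓝 p) := fun t hδ => by
    have limit := (hδ.mul_const t).const_add p
    rwa [zero_mul, add_zero] at limit
  refine tendsto_pi_nhds.mpr fun k => ?_
  rw [AffineMap.pi_lineMap_apply]
  refine tendsto_const_nhds.lineMap tendsto_const_nhds ?_
  simp only [condPosterior_interactionPosterior, condPosterior_flip_interactionPosterior]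
  split_ifs
  exacts [main_effect _ hα, main_effect _ hβ]

theorem eventually_interactionPosterior_mem {X : Type*} {l : Filter X} {p γ₀ : ℝ} {α β γ : X → ℝ}
    (hα : Tendsto α l (𝓝 0)) (hβ : Tendsto β l (𝓝 0)) (hγ : Tendsto γ l (𝓝 γ₀))
    (hmem : ∀ a b, p + γ₀ * (rareHigh a * rareLow b) ∈ Set.Ioo (0 : ℝ) 1) :
    ∀ᶠ x in l, ∀ a b, interactionPosterior p (α x) (β x) (γ x) a b ∈ Set.Icc (0 : ℝ) 1 := by
  simp only [eventually_all]
  exact fun a b => (tendsto_interactionPosterior hα hβ hγ a b).eventually_mem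
    (Icc_mem_nhds_iff.mpr (hmem a b))

variable {r r' v : Profile 2} {p α β γ : ℝ} {hp : p ∈ Set.Icc (0 : ℝ) 1}
  {hr : ∀ i, r i ∈ Set.Icc (0 : ℝ) 1} {hr' : ∀ i, r' i ∈ Set.Icc (0 : ℝ) 1} {i j : Fin 2}

/-- Bidder `i` observes `rareHigh`, the other bidder independently observes `rareLow`, and the
posterior given both observations is `interactionPosterior p α β γ`. -/
noncomputable def InfoStructure.interaction (i : Fin 2)
    (hq : ∀ a b, interactionPosterior p α β γ a b ∈ Set.Icc (0 : ℝ) 1) :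
    InfoStructure (Prior.twoPoint r r' p hp hr hr') :=
  ofObservations i rareHighLaw_mem_stdSimplex rareLowLaw_mem_stdSimplex hq
    (sum_mul_condPosterior_interactionPosterior p α β γ)

variable {hq : ∀ a b, interactionPosterior p α β γ a b ∈ Set.Icc (0 : ℝ) 1}

theorem InfoStructure.isCalibrated_interaction (i : Fin 2) :
    (interaction (hp := hp) (hr := hr) (hr' := hr') i hq).IsCalibrated :=
  isCalibrated_ofObservations i

theorem InfoStructure.revenue_interaction_of_forall_lt (hij : j ≠ i)
    (hwin : ∀ a b, v j * lineMap (r' j) (r j) (p + β * rareLow b)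
      < v i * lineMap (r' i) (r i) (p + α * rareHigh a))
    (hne : ∀ a, lineMap (r' i) (r i) (p + α * rareHigh a) ≠ 0) :
    (interaction (hp := hp) (hr := hr) (hr' := hr') i hq).revenue v
      = v j * (lineMap (r' j) (r j) p + (r i - r' i) * (r j - r' j) *
          (2 * β * (β * lineMap (r' i) (r i) (p + α) - 2 * γ * ((r i - r' i) * α))
            / ∏ a, lineMap (r' i) (r i) (p + α * rareHigh a))) := by
  have lineMap_add : ∀ t, lineMap (r' i) (r i) (p + t)
      = lineMap (r' i) (r i) p + (r i - r' i) * t := fun t => by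
    simp only [AffineMap.lineMap_apply_ring']
    ring
  rw [interaction, revenue_ofObservations_of_forall_lt hij]
  · simp only [condPosterior_interactionPosterior, condPosterior_flip_interactionPosterior,
      add_sub_cancel_left, sum_mul_interactionPosterior_mul_rareLow, lineMap_add,
      ← mul_assoc _ α] at hne ⊢
    rw [sum_rareHighLaw_mul_div hne]
  · simpa only [condPosterior_interactionPosterior, condPosterior_flip_interactionPosterior]
      using hwin
  · simpa only [condPosterior_interactionPosterior] using hne

end Interaction

section Improvement

variable {r r' v : Profile 2} {p : ℝ} {i j : Fin 2} {hr : ∀ i, r i ∈ Set.Icc (0 : ℝ) 1}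
  {hr' : ∀ i, r' i ∈ Set.Icc (0 : ℝ) 1}

theorem lineMap_pos {x y : ℝ} (hx : 0 ≤ x) (hy : 0 ≤ y) (hxy : x ≠ y)
    (hp : p ∈ Set.Ioo (0 : ℝ) 1) : 0 < lineMap x y p := by
  rw [AffineMap.lineMap_apply_ring]
  rcases hxy.lt_or_gt with h | h
  · exact add_pos_of_nonneg_of_pos (mul_nonneg (sub_nonneg.mpr hp.2.le) hx)
      (mul_pos hp.1 (hx.trans_lt h))
  · exact add_pos_of_pos_of_nonneg (mul_pos (sub_pos.mpr hp.2) (hy.trans_lt h))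
      (mul_nonneg hp.1.le hy)

theorem exists_isCalibrated_lt_revenue_of_mean_lt (hp : p ∈ Set.Ioo (0 : ℝ) 1) (hi : r i ≠ r' i)
    (hj : r j ≠ r' j) (hvj : 0 < v j)
    (hlt : v j * lineMap (r' j) (r j) p < v i * lineMap (r' i) (r i) p) :
    ∃ x : InfoStructure (Prior.twoPoint r r' p (Set.Ioo_subset_Icc_self hp) hr hr'),
      x.IsCalibrated ∧ v j * lineMap (r' j) (r j) p < x.revenue v := by
  have hij : j ≠ i := ne_of_apply_ne (fun k => v k * lineMap (r' k) (r k) p) hlt.ne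
  set D := (r i - r' i) * (r j - r' j) with hD
  have hD₀ : D ≠ 0 := mul_ne_zero (sub_ne_zero.mpr hi) (sub_ne_zero.mpr hj)
  -- The weights make the leading term of the gain `ε ^ 5` times a positive multiple of `D ^ 2`.
  have posterior : ∀ᶠ ε in 𝓝 (0 : ℝ), ∀ a b,
      interactionPosterior p ε (ε ^ 3) (-((r j - r' j) * ε)) a b ∈ Set.Icc (0 : ℝ) 1 := by
    refine eventually_interactionPosterior_mem (γ₀ := 0) tendsto_id ?_ ?_ (by simpa using hp) <;>
    exact Continuous.tendsto' (by fun_prop) _ _ (by simp)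
  have i_wins : ∀ᶠ ε in 𝓝 (0 : ℝ), ∀ a b, v j * lineMap (r' j) (r j) (p + ε ^ 3 * rareLow b)
      < v i * lineMap (r' i) (r i) (p + ε * rareHigh a) := by
    simp only [eventually_all]
    exact fun a b => ContinuousAt.eventually_lt (by fun_prop) (by fun_prop) (by simpa using hlt)
  have signal_pos : ∀ᶠ ε in 𝓝 (0 : ℝ), ∀ a, 0 < lineMap (r' i) (r i) (p + ε * rareHigh a) := by
    simp only [eventually_all]
    exact fun a => continuousAt_const.eventually_lt (by fun_prop)
      (by simpa using lineMap_pos (hr' i).1 (hr i).1 hi.symm hp)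
  have leading_pos : ∀ᶠ ε in 𝓝 (0 : ℝ),
      0 < ε * (D * lineMap (r' i) (r i) (p + ε)) + 2 * D ^ 2 :=
    continuousAt_const.eventually_lt (by fun_prop) (by simpa using sq_pos_of_ne_zero hD₀)
  obtain ⟨ε, ⟨hq, hwin, hpos, hlead⟩, hε : 0 < ε⟩ :=
    ((posterior.and (i_wins.and (signal_pos.and leading_pos))).filter_mono
      nhdsWithin_le_nhds |>.and self_mem_nhdsWithin : ∀ᶠ ε in 𝓝[>] (0 : ℝ), _).exists
  refine ⟨.interaction i hq, InfoStructure.isCalibrated_interaction i, ?_⟩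
  rw [InfoStructure.revenue_interaction_of_forall_lt hij hwin fun a => (hpos a).ne', ← hD]
  refine mul_lt_mul_of_pos_left (lt_add_of_pos_right _ ?_) hvj
  have gain : D * (2 * ε ^ 3 * (ε ^ 3 * lineMap (r' i) (r i) (p + ε)
      - 2 * -((r j - r' j) * ε) * ((r i - r' i) * ε)))
      = 2 * ε ^ 5 * (ε * (D * lineMap (r' i) (r i) (p + ε)) + 2 * D ^ 2) := by
    rw [hD]
    ring
  rw [← mul_div_assoc, gain]
  exact div_pos (mul_pos (by positivity) hlead) (prod_pos fun a _ => hpos a)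

theorem tendsto_mul_const_nhdsGT_zero (c : ℝ) :
    Tendsto (fun ε : ℝ => ε * c) (𝓝[>] 0) (𝓝 0) :=
  (Continuous.tendsto' (continuous_mul_const c) 0 0 (zero_mul c)).mono_left nhdsWithin_le_nhds

theorem mul_lineMap_add_mul {x y c α : ℝ} (hα : c * (y - x) * α = 1) (p ε t : ℝ) :
    c * lineMap x y (p + ε * α * t) = c * lineMap x y p + ε * t := by
  simp only [AffineMap.lineMap_apply_ring']
  linear_combination ε * t * hα

theorem tendsto_auctionRevenue_interaction {α β : ℝ} (hij : j ≠ i)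
    (hα : v i * (r i - r' i) * α = 1) (hβ : v j * (r j - r' j) * β = 1)
    (hmi : lineMap (r' i) (r i) p ≠ 0) (hmj : lineMap (r' j) (r j) p ≠ 0)
    (htie : v j * lineMap (r' j) (r j) p = v i * lineMap (r' i) (r i) p) (γ : ℝ) (a b : Fin 2) :
    Tendsto (fun ε => auctionRevenue v (lineMap r' r (interactionPosterior p (ε * α) (ε * β) γ a b))
        (observationSignal r r' i rareHighLaw rareLowLaw
          (interactionPosterior p (ε * α) (ε * β) γ) a b))
      (𝓝[>] 0) (𝓝 (if rareLow b < rareHigh a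
        then v i * lineMap (r' i) (r i) (p + γ * (rareHigh a * rareLow b))
        else v j * lineMap (r' j) (r j) (p + γ * (rareHigh a * rareLow b)))) := by
  set s : ℝ → Profile 2 := fun ε => observationSignal r r' i rareHighLaw rareLowLaw
    (interactionPosterior p (ε * α) (ε * β) γ) a b with hs
  have score_i : ∀ ε, v i * s ε i = v i * lineMap (r' i) (r i) p + ε * rareHigh a := fun ε => by
    simp only [hs, observationSignal_self, condPosterior_interactionPosterior,
      mul_lineMap_add_mul hα]
  have score_j : ∀ ε, v j * s ε j = v i * lineMap (r' i) (r i) p + ε * rareLow b := fun ε => by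
    simp only [hs, observationSignal_of_ne hij, condPosterior_flip_interactionPosterior,
      mul_lineMap_add_mul hβ, htie]
  have rate_limit := (tendsto_const_nhds (x := r')).lineMap (tendsto_const_nhds (x := r))
    (tendsto_interactionPosterior (p := p) (tendsto_mul_const_nhdsGT_zero α)
      (tendsto_mul_const_nhdsGT_zero β) (tendsto_const_nhds (x := γ)) a b)
  have signal_limit : Tendsto s (𝓝[>] 0) (𝓝 (lineMap r' r p)) :=
    tendsto_observationSignal_interactionPosterior i (tendsto_mul_const_nhdsGT_zero α)
      (tendsto_mul_const_nhdsGT_zero β) (fun _ => γ) a b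
  simp only [← AffineMap.pi_lineMap_apply r' r] at hmi hmj htie ⊢
  split_ifs with h
  · refine tendsto_auctionRevenue_of_tie ?_ rate_limit signal_limit hmi htie
    filter_upwards [self_mem_nhdsWithin] with ε hε
    rw [score_i, score_j]
    exact add_lt_add_right (mul_lt_mul_of_pos_left h hε) _
  · have h' := (not_lt.mp h).lt_of_ne' (rareLow_ne_rareHigh a b)
    refine tendsto_auctionRevenue_of_tie ?_ rate_limit signal_limit hmj htie.symm
    filter_upwards [self_mem_nhdsWithin] with ε hε
    rw [score_i, score_j]
    exact add_lt_add_right (mul_lt_mul_of_pos_left h' hε) _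

-- Bidder `j` wins only at `a = 1`, `b = 0`, so `γ` weighs the difference of the two slopes.
theorem sum_limit_revenue_interaction
    (htie : v j * lineMap (r' j) (r j) p = v i * lineMap (r' i) (r i) p) (γ : ℝ) :
    ∑ a, ∑ b, rareHighLaw a * rareLowLaw b * (if rareLow b < rareHigh a
        then v i * lineMap (r' i) (r i) (p + γ * (rareHigh a * rareLow b))
        else v j * lineMap (r' j) (r j) (p + γ * (rareHigh a * rareLow b)))
      = v j * lineMap (r' j) (r j) p
        + 4 / 9 * (γ * (v i * (r i - r' i) - v j * (r j - r' j))) := by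
  simp only [AffineMap.lineMap_apply_ring'] at htie
  norm_num [Fin.sum_univ_two, rareHigh, rareLow, rareHighLaw, rareLowLaw,
    AffineMap.lineMap_apply_ring']
  linear_combination (-5 / 9) * htie

theorem exists_interaction_mem_Ioo (hp : p ∈ Set.Ioo (0 : ℝ) 1) {Δ : ℝ} (hΔ : Δ ≠ 0) :
    ∃ γ, (∀ a b, p + γ * (rareHigh a * rareLow b) ∈ Set.Ioo (0 : ℝ) 1) ∧ 0 < γ * Δ := by
  have interior : ∀ᶠ η in 𝓝 (0 : ℝ), ∀ a b,
      p + η * Δ * (rareHigh a * rareLow b) ∈ Set.Ioo (0 : ℝ) 1 := by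
    simp only [eventually_all]
    exact fun a b => (Continuous.tendsto' (by fun_prop) 0 p (by simp)).eventually_mem
      (Ioo_mem_nhds hp.1 hp.2)
  obtain ⟨η, hη, hη₀ : 0 < η⟩ :=
    ((interior.filter_mono nhdsWithin_le_nhds).and self_mem_nhdsWithin :
      ∀ᶠ η in 𝓝[>] (0 : ℝ), _).exists
  refine ⟨η * Δ, hη, ?_⟩
  rw [mul_assoc]
  exact mul_pos hη₀ (mul_self_pos.mpr hΔ)

theorem exists_isCalibrated_lt_revenue_of_mean_eq (hp : p ∈ Set.Ioo (0 : ℝ) 1) (hij : j ≠ i)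
    (hvi : v i ≠ 0) (hvj : v j ≠ 0) (hi : r i ≠ r' i) (hj : r j ≠ r' j)
    (htie : v j * lineMap (r' j) (r j) p = v i * lineMap (r' i) (r i) p)
    (hne : v i * (r i - r' i) ≠ v j * (r j - r' j)) :
    ∃ x : InfoStructure (Prior.twoPoint r r' p (Set.Ioo_subset_Icc_self hp) hr hr'),
      x.IsCalibrated ∧ v j * lineMap (r' j) (r j) p < x.revenue v := by
  have hmi := (lineMap_pos (hr' i).1 (hr i).1 hi.symm hp).ne'
  have hmj := (lineMap_pos (hr' j).1 (hr j).1 hj.symm hp).ne'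
  have hα := mul_inv_cancel₀ (mul_ne_zero hvi (sub_ne_zero.mpr hi))
  have hβ := mul_inv_cancel₀ (mul_ne_zero hvj (sub_ne_zero.mpr hj))
  obtain ⟨γ, hγ, gain_pos⟩ := exists_interaction_mem_Ioo hp (sub_ne_zero.mpr hne)
  have posterior := eventually_interactionPosterior_mem
    (tendsto_mul_const_nhdsGT_zero (v i * (r i - r' i))⁻¹)
    (tendsto_mul_const_nhdsGT_zero (v j * (r j - r' j))⁻¹) tendsto_const_nhds hγ
  have revenue_limit := tendsto_finsetSum univ fun a _ => tendsto_finsetSum univ fun b _ =>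
    (tendsto_auctionRevenue_interaction hij hα hβ hmi hmj htie γ a b).const_mul
      (rareHighLaw a * rareLowLaw b)
  rw [sum_limit_revenue_interaction htie] at revenue_limit
  obtain ⟨ε, hq, hε⟩ := (posterior.and (revenue_limit.eventually_const_lt
    (lt_add_of_pos_right _ (mul_pos (by norm_num) gain_pos)))).exists
  refine ⟨.interaction i hq, InfoStructure.isCalibrated_interaction i, ?_⟩
  rwa [InfoStructure.interaction, InfoStructure.revenue_ofObservations]

theorem exists_isCalibrated_lt_revenue (hp : p ∈ Set.Ioo (0 : ℝ) 1) (hv : ∀ i, 0 < v i)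
    (hrandom : ∀ i, r i ≠ r' i) (hdistinct : ¬ (v 0 * r 0 = v 1 * r 1 ∧ v 0 * r' 0 = v 1 * r' 1)) :
    ∃ x : InfoStructure (Prior.twoPoint r r' p (Set.Ioo_subset_Icc_self hp) hr hr'),
      x.IsCalibrated ∧ ∃ k, v k * lineMap (r' k) (r k) p < x.revenue v := by
  rcases lt_trichotomy (v 0 * lineMap (r' 0) (r 0) p) (v 1 * lineMap (r' 1) (r 1) p)
    with hlt | htie | hgt
  · obtain ⟨x, hx, hrev⟩ :=
      exists_isCalibrated_lt_revenue_of_mean_lt hp (hrandom 1) (hrandom 0) (hv 0) hlt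
    exact ⟨x, hx, 0, hrev⟩
  · have hslope : v 1 * (r 1 - r' 1) ≠ v 0 * (r 0 - r' 0) := by
      intro h
      simp only [AffineMap.lineMap_apply_ring'] at htie
      exact hdistinct ⟨by linear_combination htie + (p - 1) * h, by linear_combination htie + p * h⟩
    obtain ⟨x, hx, hrev⟩ := exists_isCalibrated_lt_revenue_of_mean_eq hp zero_ne_one (hv 1).ne'
      (hv 0).ne' (hrandom 1) (hrandom 0) htie hslope
    exact ⟨x, hx, 0, hrev⟩
  · obtain ⟨x, hx, hrev⟩ :=
      exists_isCalibrated_lt_revenue_of_mean_lt hp (hrandom 0) (hrandom 1) (hv 1) hgt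
    exact ⟨x, hx, 1, hrev⟩

end Improvement

theorem mainTheorem3_general (v r r' : Profile 2) (p : ℝ) (hv : ∀ i, 0 < v i)
    (hp : p ∈ Set.Ioo (0 : ℝ) 1) (hr : ∀ i, r i ∈ Set.Icc (0 : ℝ) 1)
    (hr' : ∀ i, r' i ∈ Set.Icc (0 : ℝ) 1) (hrandom : ∀ i, r i ≠ r' i)
    (hdistinct : ¬ (v 0 * r 0 = v 1 * r 1 ∧ v 0 * r' 0 = v 1 * r' 1)) :
    ∃ x : InfoStructure (Prior.twoPoint r r' p (Set.Ioo_subset_Icc_self hp) hr hr'),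
      x.IsCalibrated ∧ x.IsModerate ∧
        ∀ y : InfoStructure (Prior.twoPoint r r' p (Set.Ioo_subset_Icc_self hp) hr hr'),
          y.IsExtremal → y.revenue v < x.revenue v := by
  obtain ⟨x, hx, k, hrev⟩ := exists_isCalibrated_lt_revenue hp hv hrandom hdistinct
  have extremal_lt (y : InfoStructure (Prior.twoPoint r r' p (Set.Ioo_subset_Icc_self hp) hr hr'))
      (hy : y.IsExtremal) : y.revenue v < x.revenue v := by
    refine (hy.revenue_le (fun i => (hv i).le) k).trans_lt ?_
    rwa [Prior.mean_twoPoint, AffineMap.pi_lineMap_apply]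
  exact ⟨x, hx, fun h => (extremal_lt x h).false, extremal_lt⟩

theorem mainTheorem3 (r r' : Profile 2) (p : ℝ) (hp : p ∈ Set.Ioo (0 : ℝ) 1)
    (hr : ∀ i, r i ∈ Set.Icc (0 : ℝ) 1) (hr' : ∀ i, r' i ∈ Set.Icc (0 : ℝ) 1)
    (hrandom : ∀ i, r i ≠ r' i)
    (hdistinct : ¬ (r 0 = r 1 ∧ r' 0 = r' 1)) :
    ∃ x : InfoStructure (Prior.twoPoint r r' p (Set.Ioo_subset_Icc_self hp) hr hr'),
      x.IsCalibrated ∧ x.IsModerate ∧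
        ∀ y : InfoStructure (Prior.twoPoint r r' p (Set.Ioo_subset_Icc_self hp) hr hr'),
          y.IsExtremal → y.revenue (fun _ => 1) < x.revenue (fun _ => 1) :=
  mainTheorem3_general _ r r' p (fun _ => one_pos) hp hr hr' hrandom
    (by simpa only [one_mul] using hdistinct)
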